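/- Let $q$ be an odd prime power, fixed, let $\mathrm{Sp}(2n,q)$ be the symplectic group of $2n\times 2n$ matrices over the field with $q$ elements, and let $i_{Sp}(2n,q)$ be the number of involutions in $\mathrm{Sp}(2n,q)$, i.e. of elements $g$ with $g^2=1$ (whether or not the identity is counted makes no difference below). All infinite products below converge. 1. As $n\to\infty$ through the even integers, $$\lim_{n\to\infty}\frac{i_{Sp}(2n,q)}{q^{n^2}}=\frac12\left[\prod_{i\ge1}\left(1+\frac1{q^{2i-1}}\right)^2+\prod_{i\ge1}\left(1-\frac1{q^{2i-1}}\right)^2\right]=\prod_{i\ge1}\frac{(1+q^{4-8i})^2(1-q^{-8i})}{1-q^{-2i}}.$$ 2. As $n\to\infty$ through the odd integers, $$\lim_{n\to\infty}\frac{i_{Sp}(2n,q)}{q^{n^2-1}}=\frac q2\left[\prod_{i\ge1}\left(1+\frac1{q^{2i-1}}\right)^2-\prod_{i\ge1}\left(1-\frac1{q^{2i-1}}\right)^2\right]=2\prod_{i\ge1}\frac{(1+q^{-8i})(1-q^{-16i})}{1-q^{-2i}}.$$ -/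

import Mathlib

open Filter Topology

/-- The number `i_Sp(2n, q)` of involutions of the symplectic group `Sp(2n, K)`, `K` a field with
`q` elements, that is of the elements `g` with `g ^ 2 = 1`.  The identity element is counted. -/
noncomputable def iSp (n : ℕ) (K : Type*) [Field K] : ℕ :=
  Nat.card {g : Matrix.symplecticGroup (Fin n) K // g ^ 2 = 1}

/-- The number of elements of order exactly two in `Sp(2n, K)`: the identity is not counted. -/
noncomputable def iSpStrict (n : ℕ) (K : Type*) [Field K] : ℕ :=
  Nat.card {g : Matrix.symplecticGroup (Fin n) K // orderOf g = 2}

/-! In odd characteristic an isometry g with g² = 1 splits the space orthogonally into its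
eigenspaces for 1 and -1, and its fixed space determines it. Hence involutions correspond to
nondegenerate subspaces (`card_isometric_involutions`). Such a subspace has even dimension 2r, and
double counting against hyperbolic pairs gives their number by induction (`card_nondegOn`):
q^(4r(n-r)) times a Gaussian binomial in the base y = q⁻².

The exponent is largest in the middle. For n = 2m and r = m + j it equals n² - 4j²; for n = 2m + 1
and r = m + 1 + j it equals n² - 1 - 4j(j + 1). After normalization the Gaussian binomials are
bounded and tend to 1/(y; y)_∞, so dominated convergence (`tendsto_tsum_mul_gaussian`) turns the
sums into theta series in q⁻⁴ divided by (y; y)_∞.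

The Jacobi triple product, obtained as the limit of its finite form (`hasSum_jacobiCoeff`), makes
products of these series. The one-product formulas apply it in base q⁻⁴. The two-product formulas
apply it in base q⁻¹ at z = 1 and z = -1, where half the sum and half the difference select the even
and the odd indices. -/

/-- The finite `q`-Pochhammer product `(y; y)_n = (1 - y) (1 - y ^ 2) ⋯ (1 - y ^ n)`. -/
noncomputable def qPoch (y : ℝ) (n : ℕ) : ℝ := ∏ i ∈ Finset.range n, (1 - y ^ (i + 1))

/-- The infinite `q`-Pochhammer product `(y; y)_∞`. -/
noncomputable def qPochInf (y : ℝ) : ℝ := ∏' i : ℕ, (1 - y ^ (i + 1))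

/-- The reciprocal `1 / (y; y)_k`, extended by `0` to negative `k`. -/
noncomputable def qPochInv (y : ℝ) (k : ℤ) : ℝ := if k < 0 then 0 else (qPoch y k.toNat)⁻¹

/-! ### Pochhammer products with base in (0, 1), and limits of Gaussian sums -/

section QPoch

variable {y : ℝ}

theorem qPoch_zero (y : ℝ) : qPoch y 0 = 1 := by simp [qPoch]

theorem qPoch_succ (y : ℝ) (n : ℕ) : qPoch y (n + 1) = qPoch y n * (1 - y ^ (n + 1)) := by
  simp [qPoch, Finset.prod_range_succ]

theorem one_sub_pow_succ_pos (h0 : 0 < y) (h1 : y < 1) (i : ℕ) : 0 < 1 - y ^ (i + 1) :=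
  sub_pos.2 (pow_lt_one₀ h0.le h1 i.succ_ne_zero)

theorem qPoch_pos (h0 : 0 < y) (h1 : y < 1) (n : ℕ) : 0 < qPoch y n :=
  Finset.prod_pos fun i _ => one_sub_pow_succ_pos h0 h1 i

theorem qPoch_le_one (h0 : 0 < y) (h1 : y < 1) (n : ℕ) : qPoch y n ≤ 1 :=
  Finset.prod_le_one (fun i _ => (one_sub_pow_succ_pos h0 h1 i).le)
    fun i _ => by linarith [pow_pos h0 (i + 1)]

theorem qPoch_antitone (h0 : 0 < y) (h1 : y < 1) : Antitone (qPoch y) := by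
  refine antitone_nat_of_succ_le fun n => ?_
  rw [qPoch_succ]
  exact mul_le_of_le_one_right (qPoch_pos h0 h1 n).le (by linarith [pow_pos h0 (n + 1)])

theorem summable_pow_succ (h0 : 0 < y) (h1 : y < 1) : Summable fun i : ℕ => y ^ (i + 1) :=
  (summable_nat_add_iff 1).2 (summable_geometric_of_lt_one h0.le h1)

theorem tendsto_qPoch (h0 : 0 < y) (h1 : y < 1) :
    Tendsto (qPoch y) atTop (𝓝 (qPochInf y)) := by
  have : Multipliable fun i : ℕ => 1 + -y ^ (i + 1) :=
    Real.multipliable_one_add_of_summable (summable_pow_succ h0 h1).neg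
  simp only [← sub_eq_add_neg] at this
  exact this.hasProd.tendsto_prod_nat

theorem qPochInf_pos (h0 : 0 < y) (h1 : y < 1) : 0 < qPochInf y := by
  refine lt_of_le_of_ne (ge_of_tendsto' (tendsto_qPoch h0 h1) fun n => (qPoch_pos h0 h1 n).le) ?_
  have := tprod_one_add_ne_zero_of_summable (f := fun i : ℕ => -y ^ (i + 1))
    (fun i => by
      have := one_sub_pow_succ_pos h0 h1 i
      rw [← sub_eq_add_neg]; exact this.ne')
    (by simpa [abs_of_pos h0] using summable_pow_succ h0 h1)
  simp only [← sub_eq_add_neg] at this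
  exact this.symm

theorem qPochInf_le (h0 : 0 < y) (h1 : y < 1) (n : ℕ) : qPochInf y ≤ qPoch y n :=
  (qPoch_antitone h0 h1).le_of_tendsto (tendsto_qPoch h0 h1) n

theorem qPochInv_natCast (y : ℝ) (n : ℕ) : qPochInv y n = (qPoch y n)⁻¹ := by
  simp [qPochInv]

theorem qPochInv_of_neg (y : ℝ) {k : ℤ} (h : k < 0) : qPochInv y k = 0 := by
  simp [qPochInv, h]

theorem qPochInv_zero (y : ℝ) : qPochInv y 0 = 1 := by
  simp [qPochInv, qPoch_zero]

/-- With reciprocals extended by zero the recurrence has no boundary case: at k = 0 the factor 1 -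
y^0 vanishes, as does the left side. Later coefficient identities thus need no range conditions. -/
theorem qPochInv_sub_one (h0 : 0 < y) (h1 : y < 1) (k : ℤ) :
    qPochInv y (k - 1) = (1 - y ^ k) * qPochInv y k := by
  rcases lt_trichotomy k 0 with h | rfl | h
  · rw [qPochInv_of_neg y h, qPochInv_of_neg y (by omega), mul_zero]
  · rw [qPochInv_of_neg y (by omega)]; simp
  · obtain ⟨n, rfl⟩ : ∃ n : ℕ, k = ((n + 1 : ℕ) : ℤ) := ⟨(k - 1).toNat, by omega⟩
    have e : ((n + 1 : ℕ) : ℤ) - 1 = n := by push_cast; ring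
    rw [e, qPochInv_natCast, qPochInv_natCast, qPoch_succ, zpow_natCast]
    have := (qPoch_pos h0 h1 n).ne'
    have := (one_sub_pow_succ_pos h0 h1 n).ne'
    field_simp

theorem qPochInv_nonneg (h0 : 0 < y) (h1 : y < 1) (k : ℤ) : 0 ≤ qPochInv y k := by
  unfold qPochInv
  split_ifs
  · exact le_rfl
  · exact (inv_pos.2 (qPoch_pos h0 h1 _)).le

theorem qPochInv_le (h0 : 0 < y) (h1 : y < 1) (k : ℤ) : qPochInv y k ≤ (qPochInf y)⁻¹ := by
  unfold qPochInv
  split_ifs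
  · exact (inv_pos.2 (qPochInf_pos h0 h1)).le
  · exact inv_anti₀ (qPochInf_pos h0 h1) (qPochInf_le h0 h1 _)

theorem tendsto_qPochInv (h0 : 0 < y) (h1 : y < 1) :
    Tendsto (qPochInv y) atTop (𝓝 (qPochInf y)⁻¹) := by
  have h2 : Tendsto (fun n : ℕ => (qPoch y n)⁻¹) atTop (𝓝 (qPochInf y)⁻¹) :=
    (tendsto_qPoch h0 h1).inv₀ (qPochInf_pos h0 h1).ne'
  have h3 : Tendsto (fun k : ℤ => k.toNat) atTop atTop :=
    tendsto_atTop.2 fun n => (eventually_ge_atTop (n : ℤ)).mono fun k hk => by omega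
  refine (h2.comp h3).congr' ?_
  filter_upwards [eventually_ge_atTop 0] with k hk
  simp [qPochInv, not_lt.2 hk]

/-- Weighted sums of Gaussian binomial coefficients converge, by dominated convergence. -/
theorem tendsto_tsum_mul_gaussian (h0 : 0 < y) (h1 : y < 1) {w : ℤ → ℝ} (hw : Summable w)
    {e : ℕ → ℕ} {a b : ℕ → ℤ} (he : Tendsto e atTop atTop) (ha : Tendsto a atTop atTop)
    (hb : Tendsto b atTop atTop) :
    Tendsto (fun m => ∑' j : ℤ, w j * (qPoch y (e m) * qPochInv y (a m + j) * qPochInv y (b m - j)))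
      atTop (𝓝 ((∑' j, w j) / qPochInf y)) := by
  have hP := qPochInf_pos h0 h1
  rw [← tsum_div_const]
  -- The numerator is at most 1 and each reciprocal at most 1/(y; y)_∞, uniformly in m.
  refine tendsto_tsum_of_dominated_convergence
    (bound := fun j => |w j| * ((qPochInf y)⁻¹ * (qPochInf y)⁻¹)) (hw.abs.mul_right _) ?_ ?_
  · intro j
    have h2 := (tendsto_qPoch h0 h1).comp he
    have h3 := (tendsto_qPochInv h0 h1).comp (tendsto_atTop_add_const_right _ j ha)
    have h4 := (tendsto_qPochInv h0 h1).comp (tendsto_atTop_add_const_right _ (-j) hb)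
    have h5 := ((h2.mul h3).mul h4).const_mul (w j)
    rw [mul_inv_cancel₀ hP.ne', one_mul, ← div_eq_mul_inv] at h5
    simpa [Function.comp_def, sub_eq_add_neg] using h5
  · refine Eventually.of_forall fun m j => ?_
    have h2 := qPochInv_nonneg h0 h1 (a m + j)
    have h3 := qPochInv_nonneg h0 h1 (b m - j)
    have h4 := (qPoch_pos h0 h1 (e m)).le
    rw [Real.norm_eq_abs, abs_mul, abs_of_nonneg (mul_nonneg (mul_nonneg h4 h2) h3)]
    refine mul_le_mul_of_nonneg_left ?_ (abs_nonneg _)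
    refine mul_le_mul ?_ (qPochInv_le h0 h1 _) h3 (inv_pos.2 hP).le
    calc qPoch y (e m) * qPochInv y (a m + j) ≤ 1 * qPochInv y (a m + j) :=
          mul_le_mul_of_nonneg_right (qPoch_le_one h0 h1 _) h2
      _ ≤ _ := by rw [one_mul]; exact qPochInv_le h0 h1 _

end QPoch

/-! ### The Jacobi triple product -/

section Jacobi

variable {x : ℝ}

/-- The coefficients of the finite form of the Jacobi triple product. -/
noncomputable def jacobiCoeff (x : ℝ) (m : ℕ) (j : ℤ) : ℝ :=
  x ^ (j ^ 2) * (qPoch (x ^ 2) (2 * m) * qPochInv (x ^ 2) (m + j) * qPochInv (x ^ 2) (m - j))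

/-- This compares coefficients of z^j after multiplication by (1 + z x^(2m+1))(1 + z⁻¹ x^(2m+1)) = 1
+ x^(2(2m+1)) + x^(2m+1)(z + z⁻¹). -/
theorem jacobiCoeff_succ (h0 : 0 < x) (h1 : x < 1) (m : ℕ) (j : ℤ) :
    jacobiCoeff x (m + 1) j = (1 + x ^ (2 * (2 * m + 1))) * jacobiCoeff x m j +
      x ^ (2 * m + 1) * (jacobiCoeff x m (j - 1) + jacobiCoeff x m (j + 1)) := by
  have y0 : 0 < x ^ 2 := by positivity
  have y1 : x ^ 2 < 1 := pow_lt_one₀ h0.le h1 two_ne_zero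
  have hx := h0.ne'
  unfold jacobiCoeff
  have e1 := qPochInv_sub_one y0 y1 (m + 1 + j)
  have e2 := qPochInv_sub_one y0 y1 (m + 1 - j)
  have e3 := qPochInv_sub_one y0 y1 (m + j)
  have e4 := qPochInv_sub_one y0 y1 (m - j)
  rw [show (m : ℤ) + 1 + j - 1 = m + j by ring] at e1
  rw [show (m : ℤ) + 1 - j - 1 = m - j by ring] at e2
  rw [show (m : ℤ) + (j - 1) = m + j - 1 by ring, show (m : ℤ) - (j - 1) = m + 1 - j by ring,
    show (m : ℤ) + (j + 1) = m + 1 + j by ring, show (m : ℤ) - (j + 1) = m - j - 1 by ring,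
    e3, e4, e1, e2, show 2 * (m + 1) = 2 * m + 1 + 1 by ring, qPoch_succ, qPoch_succ]
  push_cast
  -- Every term is now a multiple of the same reciprocals A and B; what remains is a rational
  -- identity in x, u = x^j and v = x^m.
  generalize qPochInv (x ^ 2) (m + 1 + j) = A
  generalize qPochInv (x ^ 2) (m + 1 - j) = B
  generalize qPoch (x ^ 2) (2 * m) = C
  have hu : x ^ j ≠ 0 := zpow_ne_zero _ hx
  have f1 : x ^ ((j - 1) ^ 2) = x ^ (j ^ 2) * x / (x ^ j) ^ 2 := by
    rw [show (j - 1) ^ 2 = j ^ 2 + 1 - j * 2 by ring, zpow_sub₀ hx, zpow_add₀ hx, zpow_mul,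
      zpow_one]
    norm_cast
  have f2 : x ^ ((j + 1) ^ 2) = x ^ (j ^ 2) * x * (x ^ j) ^ 2 := by
    rw [show (j + 1) ^ 2 = j ^ 2 + 1 + j * 2 by ring, zpow_add₀ hx, zpow_add₀ hx, zpow_mul,
      zpow_one]
    norm_cast
  have g (k : ℤ) : (x ^ 2) ^ k = (x ^ k) ^ 2 := by
    rw [← zpow_natCast, ← zpow_natCast, ← zpow_mul, ← zpow_mul, mul_comm]
  have g1 : (x ^ 2) ^ ((m : ℤ) + 1 + j) = (x ^ m * x * x ^ j) ^ 2 := by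
    rw [g, zpow_add₀ hx, zpow_add₀ hx, zpow_natCast, zpow_one]
  have g2 : (x ^ 2) ^ ((m : ℤ) + 1 - j) = (x ^ m * x / x ^ j) ^ 2 := by
    rw [g, zpow_sub₀ hx, zpow_add₀ hx, zpow_natCast, zpow_one]
  have g3 : (x ^ 2) ^ ((m : ℤ) + j) = (x ^ m * x ^ j) ^ 2 := by
    rw [g, zpow_add₀ hx, zpow_natCast]
  have g4 : (x ^ 2) ^ ((m : ℤ) - j) = (x ^ m / x ^ j) ^ 2 := by
    rw [g, zpow_sub₀ hx, zpow_natCast]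
  have p1 : (x ^ 2) ^ (2 * m + 1) = (x ^ m) ^ 4 * x ^ 2 := by ring
  have p2 : (x ^ 2) ^ (2 * m + 1 + 1) = (x ^ m) ^ 4 * x ^ 4 := by ring
  have p3 : x ^ (2 * (2 * m + 1)) = (x ^ m) ^ 4 * x ^ 2 := by ring
  have p4 : x ^ (2 * m + 1) = (x ^ m) ^ 2 * x := by ring
  rw [f1, f2, g1, g2, g3, g4, p1, p2, p3, p4]
  clear f1 f2 g g1 g2 g3 g4 p1 p2 p3 p4 e1 e2 e3 e4
  generalize x ^ (j ^ 2) = D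
  generalize x ^ j = u at *
  generalize x ^ m = v
  field_simp
  ring

theorem hasSum_jacobiCoeff (h0 : 0 < x) (h1 : x < 1) {z : ℝ} (hz : z ≠ 0) (m : ℕ) :
    HasSum (fun j : ℤ => z ^ j * jacobiCoeff x m j)
      (∏ i ∈ Finset.range m, ((1 + z * x ^ (2 * i + 1)) * (1 + z⁻¹ * x ^ (2 * i + 1)))) := by
  induction m with
  | zero =>
    have := hasSum_single (f := fun j : ℤ => z ^ j * jacobiCoeff x 0 j) 0 fun j hj => by
      rcases lt_or_gt_of_ne hj with h | h
      · simp [jacobiCoeff, qPochInv_of_neg _ h]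
      · simp [jacobiCoeff, qPochInv_of_neg _ (neg_neg_of_pos h)]
    simpa [jacobiCoeff, qPochInv_zero, qPoch_zero] using this
  | succ m ih =>
    -- Multiplying by z or z⁻¹ shifts the summation index by one.
    have s1 := ((Equiv.subRight (1 : ℤ)).hasSum_iff.2 ih).mul_left (x ^ (2 * m + 1) * z)
    have s2 := ((Equiv.addRight (1 : ℤ)).hasSum_iff.2 ih).mul_left (x ^ (2 * m + 1) * z⁻¹)
    have s := ((ih.mul_left (1 + x ^ (2 * (2 * m + 1)))).add s1).add s2
    have hF (F : ℝ) : (1 + x ^ (2 * (2 * m + 1))) * F + x ^ (2 * m + 1) * z * F +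
        x ^ (2 * m + 1) * z⁻¹ * F = F * ((1 + z * x ^ (2 * m + 1)) * (1 + z⁻¹ * x ^ (2 * m + 1))) := by
      field_simp
      ring
    rw [hF] at s
    rw [Finset.prod_range_succ]
    refine (congrArg (fun f => HasSum f _) (funext fun j => ?_)).mpr s
    simp only [Function.comp_apply, Equiv.subRight_apply, Equiv.coe_addRight]
    rw [jacobiCoeff_succ h0 h1, zpow_add₀ hz, zpow_sub₀ hz, zpow_one]
    field_simp
    ring

theorem summable_zpow_mul_zpow_sq (h0 : 0 < x) (h1 : x < 1) {z : ℝ} (hz : z ≠ 0) :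
    Summable fun j : ℤ => z ^ j * x ^ (j ^ 2) := by
  have key : ∀ w : ℝ, w ≠ 0 → Summable fun n : ℕ => w ^ n * x ^ (n ^ 2) := by
    intro w hw
    -- Consecutive terms have ratio |w| x^(2n+1) in absolute value, which tends to 0 whatever the
    -- size of w.
    refine summable_of_ratio_test_tendsto_lt_one (l := 0) one_pos
      (Eventually.of_forall fun n => mul_ne_zero (pow_ne_zero _ hw) (pow_ne_zero _ h0.ne')) ?_
    have t : Tendsto (fun n : ℕ => |w| * x * (x ^ 2) ^ n) atTop (𝓝 (|w| * x * 0)) :=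
      (tendsto_pow_atTop_nhds_zero_of_lt_one (by positivity)
        (pow_lt_one₀ h0.le h1 two_ne_zero)).const_mul _
    rw [mul_zero] at t
    refine t.congr fun n => ?_
    have := abs_pos.2 hw
    simp only [norm_mul, norm_pow, Real.norm_eq_abs, abs_of_pos h0]
    rw [show (n + 1) ^ 2 = n ^ 2 + 2 * n + 1 by ring]
    simp only [pow_add, pow_mul, pow_one]
    field_simp
  refine Summable.of_nat_of_neg ?_ ?_
  · refine (key z hz).congr fun n => ?_
    norm_cast
  · refine (key z⁻¹ (inv_ne_zero hz)).congr fun n => ?_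
    rw [neg_sq, zpow_neg, inv_pow]
    norm_cast

/-- The Jacobi triple product identity, for partial products. -/
theorem tendsto_jacobi_triple_product (h0 : 0 < x) (h1 : x < 1) {z : ℝ} (hz : z ≠ 0) :
    Tendsto (fun m : ℕ => ∏ i ∈ Finset.range m,
        ((1 + z * x ^ (2 * i + 1)) * (1 + z⁻¹ * x ^ (2 * i + 1)))) atTop
      (𝓝 ((∑' j : ℤ, z ^ j * x ^ (j ^ 2)) / qPochInf (x ^ 2))) := by
  have hc : Tendsto (fun m : ℕ => (m : ℤ)) atTop atTop := tendsto_natCast_atTop_atTop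
  refine (tendsto_tsum_mul_gaussian (y := x ^ 2) (by positivity)
    (pow_lt_one₀ h0.le h1 two_ne_zero) (summable_zpow_mul_zpow_sq h0 h1 hz)
    (tendsto_id.const_mul_atTop' two_pos) hc hc).congr fun m => ?_
  rw [← (hasSum_jacobiCoeff h0 h1 hz m).tsum_eq]
  refine tsum_congr fun j => ?_
  simp [jacobiCoeff, mul_assoc]

end Jacobi

/-! ### Double counting, hyperbolic pairs and nondegenerate subspaces -/

theorem Nat.card_mul_eq_card_mul_of_relation {α β : Type*} [Finite α] [Finite β]
    (R : α → β → Prop) {c d : ℕ} (hc : ∀ a, Nat.card {b // R a b} = c)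
    (hd : ∀ b, Nat.card {a // R a b} = d) : Nat.card α * c = Nat.card β * d := by
  classical
  have := Fintype.ofFinite α
  have := Fintype.ofFinite β
  have e : (Σ a, {b // R a b}) ≃ Σ b, {a // R a b} :=
    ⟨fun p => ⟨p.2.1, p.1, p.2.2⟩, fun p => ⟨p.2.1, p.1, p.2.2⟩, fun _ => rfl, fun _ => rfl⟩
  have h := Nat.card_congr e
  rw [Nat.card_sigma, Nat.card_sigma, Finset.sum_congr rfl fun a _ => hc a,
    Finset.sum_congr rfl fun b _ => hd b] at h
  simpa [Nat.card_eq_fintype_card] using h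

namespace LinearMap.BilinForm

open Module
open LinearMap (BilinForm)

universe u v

variable {K : Type u} {V : Type v} [Field K] [AddCommGroup V] [Module K V]

/-- The restriction of the bilinear form `B` to the subspace `W` is (left) nondegenerate. -/
def NondegOn (B : BilinForm K V) (W : Submodule K V) : Prop :=
  ∀ x ∈ W, (∀ y ∈ W, B x y = 0) → x = 0

variable {B : BilinForm K V}

theorem nondegOn_bot (B : BilinForm K V) : B.NondegOn ⊥ := fun _ hx _ => hx

theorem nondegOn_iff_restrict (hB : B.IsRefl) {W : Submodule K V} :
    B.NondegOn W ↔ (B.restrict W).Nondegenerate := by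
  have hr : (B.restrict W).IsRefl := fun x y => hB x y
  rw [Nondegenerate, hr.nondegenerate_iff_separatingLeft]
  constructor
  · intro h x hx
    exact Subtype.ext (h x x.2 fun y hy => hx ⟨y, hy⟩)
  · intro h x hx h2
    exact congrArg Subtype.val (h ⟨x, hx⟩ fun y => h2 y y.2)

theorem nondegOn_top_iff (hB : B.IsRefl) : B.NondegOn ⊤ ↔ B.Nondegenerate := by
  rw [Nondegenerate, hB.nondegenerate_iff_separatingLeft]
  simp [NondegOn, LinearMap.SeparatingLeft]

theorem nondegOn_restrict_iff {S : Submodule K V} {W : Submodule K S} :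
    (B.restrict S).NondegOn W ↔ B.NondegOn (W.map S.subtype) := by
  constructor
  · rintro h _ ⟨x, hx, rfl⟩ h2
    have := h x hx fun y hy => h2 y ⟨y, hy, rfl⟩
    simp [this]
  · intro h x hx h2
    refine Subtype.ext (h x ⟨x, hx, rfl⟩ ?_)
    rintro _ ⟨y, hy, rfl⟩
    exact h2 y hy

/-- The summands are orthogonal, so each component of a radical vector lies in the radical of its
own summand, and that of U is zero. -/
theorem NondegOn.sup_iff (hB : B.IsRefl) {U W : Submodule K V} (hU : B.NondegOn U)
    (hW : W ≤ B.orthogonal U) : B.NondegOn (W ⊔ U) ↔ B.NondegOn W := by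
  have h1 (u) (hu : u ∈ U) (w) (hw : w ∈ W) : B u w = 0 := hW hw u hu
  have h2 (u) (hu : u ∈ U) (w) (hw : w ∈ W) : B w u = 0 := hB _ _ (h1 u hu w hw)
  constructor
  · intro h x hx h3
    refine h x (Submodule.mem_sup_left hx) fun y hy => ?_
    obtain ⟨w, hw, u, hu, rfl⟩ := Submodule.mem_sup.1 hy
    rw [map_add, h3 w hw, h2 u hu x hx, add_zero]
  · intro h x hx h3
    obtain ⟨w, hw, u, hu, rfl⟩ := Submodule.mem_sup.1 hx
    have hu0 : u = 0 := hU u hu fun y hy => by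
      have := h3 y (Submodule.mem_sup_right hy)
      rwa [map_add, LinearMap.add_apply, h2 y hy w hw, zero_add] at this
    subst hu0
    rw [add_zero] at h3 ⊢
    exact h w hw fun y hy => h3 y (Submodule.mem_sup_left hy)

/-- The span of a hyperbolic pair. -/
abbrev pairSpan (K : Type u) {V : Type v} [Field K] [AddCommGroup V] [Module K V] (p : V × V) :
    Submodule K V := Submodule.span K {p.1, p.2}

theorem nondegOn_pairSpan (hB : B.IsAlt) {p : V × V} (hp : B p.1 p.2 = 1) :
    B.NondegOn (pairSpan K p) := by
  intro x hx h
  obtain ⟨a, b, rfl⟩ := Submodule.mem_span_pair.1 hx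
  have h1 := h p.1 (Submodule.subset_span (by simp))
  have h2 := h p.2 (Submodule.subset_span (by simp))
  have h3 : B p.2 p.1 = -1 := by rw [← hB.neg_eq, hp]
  simp [hB.self_eq_zero, hp, h3] at h1 h2
  simp [h1, h2]

theorem finrank_pairSpan (hB : B.IsAlt) {p : V × V} (hp : B p.1 p.2 = 1) :
    finrank K (pairSpan K p) = 2 := by
  have h3 : B p.2 p.1 = -1 := by rw [← hB.neg_eq, hp]
  have hli : LinearIndependent K ![p.1, p.2] := by
    rw [LinearIndependent.pair_iff]
    intro a b h
    have h1 := congrArg (fun v => B v p.1) h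
    have h2 := congrArg (fun v => B v p.2) h
    simp [hB.self_eq_zero, hp, h3] at h1 h2
    exact ⟨h2, h1⟩
  have := finrank_span_eq_card hli
  rw [Matrix.range_cons, Matrix.range_cons, Matrix.range_empty, Set.union_empty] at this
  exact this

theorem pairSpan_le_iff {p : V × V} {W : Submodule K V} :
    pairSpan K p ≤ W ↔ p.1 ∈ W ∧ p.2 ∈ W := by
  rw [Submodule.span_le, Set.insert_subset_iff, Set.singleton_subset_iff]
  rfl

theorem exists_hyperbolic (hn : B.Nondegenerate) {x : V} (hx : x ≠ 0) : ∃ y, B x y = 1 := by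
  obtain ⟨y, hy⟩ : ∃ y, B x y ≠ 0 := by
    by_contra! h
    exact hx (hn.1 x h)
  exact ⟨(B x y)⁻¹ • y, by simp [hy]⟩

theorem IsAlt.restrict (hB : B.IsAlt) (W : Submodule K V) : (B.restrict W).IsAlt :=
  fun x => hB x

variable [FiniteDimensional K V]

theorem NondegOn.isCompl (hB : B.IsRefl) {W : Submodule K V} (hW : B.NondegOn W) :
    IsCompl W (B.orthogonal W) :=
  (restrict_nondegenerate_iff_isCompl_orthogonal hB).1 ((nondegOn_iff_restrict hB).1 hW)

theorem NondegOn.orthogonal (hB : B.IsRefl) (hn : B.Nondegenerate) {U : Submodule K V}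
    (hU : B.NondegOn U) : B.NondegOn (B.orthogonal U) := by
  rw [← hU.sup_iff hB le_rfl, sup_comm, (hU.isCompl hB).sup_eq_top, nondegOn_top_iff hB]
  exact hn

/-- Nondegenerate subspaces containing the nondegenerate subspace `U` correspond to nondegenerate
subspaces of the orthogonal complement of `U`. -/
theorem card_nondegOn_ge (hB : B.IsRefl) {U : Submodule K V} (hU : B.NondegOn U) (d : ℕ) :
    Nat.card {W : Submodule K V // (B.NondegOn W ∧ finrank K W = d + finrank K U) ∧ U ≤ W} =
      Nat.card {W : Submodule K (B.orthogonal U) //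
        (B.restrict (B.orthogonal U)).NondegOn W ∧ finrank K W = d} := by
  have hc := hU.isCompl hB
  -- By modularity W ↦ W ⊔ U is an isomorphism from the subspaces of the complement onto the
  -- subspaces containing U.
  let φ := (B.orthogonal U).mapIic.trans hc.symm.IicOrderIsoIci
  have hφ (W) : (φ W : Submodule K V) = W.map (B.orthogonal U).subtype ⊔ U := rfl
  have hle (W : Submodule K (B.orthogonal U)) :
      W.map (B.orthogonal U).subtype ≤ B.orthogonal U := Submodule.map_subtype_le _ _
  have hfin (W) : finrank K (φ W : Submodule K V) = finrank K W + finrank K U := by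
    rw [hφ, ← Submodule.finrank_map_subtype_eq (B.orthogonal U) W,
      ← Submodule.finrank_sup_add_finrank_inf_eq,
      (hc.disjoint.symm.mono_left (hle W)).eq_bot, finrank_bot, add_zero]
  have e1 : {W : Submodule K V // (B.NondegOn W ∧ finrank K W = d + finrank K U) ∧ U ≤ W} ≃
      {W : Set.Ici U // B.NondegOn W.1 ∧ finrank K W.1 = d + finrank K U} :=
    ⟨fun W => ⟨⟨W.1, W.2.2⟩, W.2.1⟩, fun W => ⟨W.1.1, W.2, W.1.2⟩, fun _ => rfl, fun _ => rfl⟩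
  refine Nat.card_congr (e1.trans (Equiv.subtypeEquiv φ.toEquiv fun W => ?_).symm)
  rw [nondegOn_restrict_iff]
  change _ ↔ B.NondegOn (φ W : Submodule K V) ∧ finrank K (φ W : Submodule K V) = _
  rw [hfin, hφ, hU.sup_iff hB (hle W), add_left_inj]

theorem finrank_orthogonal_pairSpan (hB : B.IsAlt) {p : V × V}
    (hp : B p.1 p.2 = 1) : finrank K (B.orthogonal (pairSpan K p)) + 2 = finrank K V := by
  have := Submodule.finrank_add_eq_of_isCompl ((nondegOn_pairSpan hB hp).isCompl hB.isRefl)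
  rw [finrank_pairSpan hB hp] at this
  omega

theorem nondegenerate_restrict_orthogonal_pairSpan (hB : B.IsAlt) (hn : B.Nondegenerate)
    {p : V × V} (hp : B p.1 p.2 = 1) :
    (B.restrict (B.orthogonal (pairSpan K p))).Nondegenerate :=
  (nondegOn_iff_restrict hB.isRefl).1 ((nondegOn_pairSpan hB hp).orthogonal hB.isRefl hn)

/-- A space with a nondegenerate alternating form has even dimension. -/
theorem IsAlt.even_finrank (hB : B.IsAlt) (hn : B.Nondegenerate) : Even (finrank K V) := by
  induction hm : finrank K V using Nat.strong_induction_on generalizing V with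
  | _ m ih =>
    rcases Nat.eq_zero_or_pos m with rfl | h
    · simp
    · obtain ⟨x, hx⟩ := Module.finrank_pos_iff_exists_ne_zero.1 (hm ▸ h)
      -- Split off the hyperbolic plane of x and y; its orthogonal complement is nondegenerate of
      -- dimension two less.
      obtain ⟨y, hy⟩ := exists_hyperbolic hn hx
      have h2 := finrank_orthogonal_pairSpan (p := (x, y)) hB hy
      have := ih _ (by omega) (hB.restrict _)
        (nondegenerate_restrict_orthogonal_pairSpan (p := (x, y)) hB hn hy) rfl
      rw [← hm, ← h2]
      exact this.add even_two

/-- The solutions form a coset of the kernel of the nonzero functional `B x`. -/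
theorem card_apply_eq_one (hn : B.Nondegenerate) {x : V} (hx : x ≠ 0) :
    Nat.card {y // B x y = 1} = Nat.card K ^ (finrank K V - 1) := by
  obtain ⟨y, hy⟩ := exists_hyperbolic hn hx
  have h0 : B x ≠ 0 := fun h => by simp [h] at hy
  have e : {z // B x z = 1} ≃ LinearMap.ker (B x) :=
    ⟨fun z => ⟨z.1 - y, by simp [z.2, hy]⟩, fun z => ⟨z.1 + y, by simp [hy]⟩,
      fun z => by simp, fun z => by simp⟩
  rw [Nat.card_congr e, Module.natCard_eq_pow_finrank (K := K)]
  have := Module.Dual.finrank_ker_add_one_of_ne_zero h0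
  rw [← this, Nat.add_sub_cancel]

theorem card_nondegOn_zero (B : BilinForm K V) :
    Nat.card {W : Submodule K V // B.NondegOn W ∧ finrank K W = 0} = 1 := by
  rw [Nat.card_eq_one_iff_unique]
  refine ⟨⟨fun W W' => Subtype.ext ?_⟩, ⟨⟨⊥, B.nondegOn_bot, finrank_bot K V⟩⟩⟩
  rw [Submodule.finrank_eq_zero.1 W.2.2, Submodule.finrank_eq_zero.1 W'.2.2]

section Finite

variable [Finite K]

/-- The number of hyperbolic pairs. -/
theorem card_hyperbolic (hn : B.Nondegenerate) :
    Nat.card {p : V × V // B p.1 p.2 = 1} =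
      (Nat.card K ^ finrank K V - 1) * Nat.card K ^ (finrank K V - 1) := by
  classical
  have : Finite V := Module.finite_of_finite K
  have := Fintype.ofFinite V
  have e : {p : V × V // B p.1 p.2 = 1} ≃ Σ x : {x : V // x ≠ 0}, {y // B x y = 1} :=
    ⟨fun p => ⟨⟨p.1.1, fun h => by simpa [h] using p.2⟩, p.1.2, p.2⟩,
      fun p => ⟨(p.1.1, p.2.1), p.2.2⟩, fun _ => rfl, fun _ => rfl⟩
  rw [Nat.card_congr e, Nat.card_sigma,
    Finset.sum_congr rfl fun x _ => card_apply_eq_one hn x.2]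
  rw [Finset.sum_const, smul_eq_mul, Finset.card_univ, ← Nat.card_eq_fintype_card]
  congr 1
  rw [← Module.natCard_eq_pow_finrank (K := K) (V := V), Nat.card_eq_fintype_card,
    Nat.card_eq_fintype_card, Fintype.card_subtype_compl, Fintype.card_subtype_eq]

/-- Double counting of pairs of a nondegenerate subspace and a hyperbolic pair in it. -/
theorem card_nondegOn_mul (hB : B.IsAlt) (hn : B.Nondegenerate) {d c : ℕ}
    (h : ∀ p : V × V, B p.1 p.2 = 1 →
      Nat.card {W : Submodule K (B.orthogonal (pairSpan K p)) //
        (B.restrict (B.orthogonal (pairSpan K p))).NondegOn W ∧ finrank K W = d} = c) :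
    Nat.card {W : Submodule K V // B.NondegOn W ∧ finrank K W = d + 2} *
        ((Nat.card K ^ (d + 2) - 1) * Nat.card K ^ (d + 1)) =
      (Nat.card K ^ finrank K V - 1) * Nat.card K ^ (finrank K V - 1) * c := by
  have : Finite V := Module.finite_of_finite K
  rw [← card_hyperbolic hn]
  -- The incidence relation is that both vectors of the pair lie in W.
  refine Nat.card_mul_eq_card_mul_of_relation (fun W p => pairSpan K p.1 ≤ W.1) ?_ ?_
  · intro W
    have h1 := card_hyperbolic ((nondegOn_iff_restrict hB.isRefl).1 W.2.1)
    rw [W.2.2] at h1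
    rw [show d + 1 = d + 2 - 1 from rfl, ← h1]
    exact Nat.card_congr
      ⟨fun p => ⟨(⟨p.1.1.1, (pairSpan_le_iff.1 p.2).1⟩, ⟨p.1.1.2, (pairSpan_le_iff.1 p.2).2⟩),
          p.1.2⟩,
        fun p => ⟨⟨(p.1.1, p.1.2), p.2⟩, pairSpan_le_iff.2 ⟨p.1.1.2, p.1.2.2⟩⟩,
        fun _ => rfl, fun _ => rfl⟩
  · intro p
    rw [← h p.1 p.2, ← card_nondegOn_ge hB.isRefl (nondegOn_pairSpan hB p.2),
      finrank_pairSpan hB p.2]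
    exact Nat.card_congr (Equiv.subtypeSubtypeEquivSubtypeInter _ _)

/-- The number of nondegenerate subspaces of dimension `2 r` of a symplectic space of dimension
`2 n` is a Gaussian binomial coefficient up to a power of the cardinality of the field. -/
theorem card_nondegOn (hB : B.IsAlt) (hn : B.Nondegenerate) {n : ℕ} (hV : finrank K V = 2 * n)
    (r : ℕ) :
    (Nat.card {W : Submodule K V // B.NondegOn W ∧ finrank K W = 2 * r} : ℝ) =
      (Nat.card K : ℝ) ^ (4 * (r : ℤ) * (n - r)) * (qPoch (((Nat.card K : ℝ) ^ 2)⁻¹) n *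
        qPochInv (((Nat.card K : ℝ) ^ 2)⁻¹) r * qPochInv (((Nat.card K : ℝ) ^ 2)⁻¹) (n - r)) := by
  have hq : (1 : ℝ) < Nat.card K := by exact_mod_cast Finite.one_lt_card
  have hq0 : (0 : ℝ) < Nat.card K := by linarith
  have y0 : (0 : ℝ) < ((Nat.card K : ℝ) ^ 2)⁻¹ := by positivity
  have y1 : ((Nat.card K : ℝ) ^ 2)⁻¹ < 1 := inv_lt_one_of_one_lt₀ (one_lt_pow₀ hq two_ne_zero)
  induction r generalizing V n with
  | zero =>
    rw [mul_zero, card_nondegOn_zero]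
    simp [qPochInv_zero, qPochInv_natCast, (qPoch_pos y0 y1 n).ne']
  | succ r ih =>
    rcases n with _ | n
    -- For n = 0 both sides vanish: no subspace is that large, and the reciprocal has negative
    -- index.
    · rw [qPochInv_of_neg _ (k := ((0 : ℕ) : ℤ) - ((r + 1 : ℕ) : ℤ)) (by omega)]
      have : IsEmpty {W : Submodule K V // B.NondegOn W ∧ finrank K W = 2 * (r + 1)} :=
        ⟨fun W => by
          have := W.1.finrank_le
          have := W.2.2
          omega⟩
      simp
    · obtain ⟨x, hx⟩ := Module.finrank_pos_iff_exists_ne_zero.1 (show 0 < finrank K V by omega)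
      obtain ⟨y, hy⟩ := exists_hyperbolic hn hx
      have hdim (p : V × V) (hp : B p.1 p.2 = 1) :
          finrank K (B.orthogonal (pairSpan K p)) = 2 * n := by
        have := finrank_orthogonal_pairSpan hB hp
        omega
      have key (p : V × V) (hp : B p.1 p.2 = 1) := ih (hB.restrict _)
        (nondegenerate_restrict_orthogonal_pairSpan hB hn hp) (hdim p hp)
      -- By induction the count in the complement depends only on its dimension, hence is the same
      -- for every hyperbolic pair; the pair (x, y) serves to name it.
      have hmul := card_nondegOn_mul hB hn (d := 2 * r) fun p hp =>
        Nat.cast_injective (R := ℝ) ((key p hp).trans (key (x, y) hy).symm)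
      rw [hV, ← @Nat.cast_inj ℝ, Nat.cast_mul, Nat.cast_mul _ (Nat.card _), key (x, y) hy] at hmul
      have hone (k : ℕ) : 1 ≤ Nat.card K ^ k := Nat.one_le_pow _ _ Nat.card_pos
      push_cast [hone] at hmul
      have hr := qPochInv_sub_one y0 y1 (r + 1)
      rw [add_sub_cancel_right] at hr
      rw [hr] at hmul
      rw [show 2 * (r + 1) = 2 * r + 2 from rfl, qPoch_succ]
      push_cast
      rw [show (n : ℤ) + 1 - (r + 1) = n - r by ring]
      generalize qPochInv ((Nat.card K ^ 2 : ℝ)⁻¹) (r + 1) = R at *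
      generalize qPochInv ((Nat.card K ^ 2 : ℝ)⁻¹) (n - r) = S at *
      generalize qPoch ((Nat.card K ^ 2 : ℝ)⁻¹) n = P at *
      have hne : ((Nat.card K : ℝ) ^ (2 * r + 2) - 1) * (Nat.card K : ℝ) ^ (2 * r + 1) ≠ 0 :=
        mul_ne_zero (sub_pos.2 (one_lt_pow₀ hq (by omega))).ne' (by positivity)
      refine mul_right_cancel₀ hne (hmul.trans ?_)
      rw [show 2 * (n + 1) - 1 = 2 * n + 1 by omega,
        show 4 * ((r : ℤ) + 1) * (n - r) = 4 * r * (n - r) + 4 * (n : ℤ) - 4 * (r : ℤ) by ring,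
        zpow_sub₀ hq0.ne', zpow_add₀ hq0.ne', show (4 * (n : ℤ)) = (4 * n : ℕ) by push_cast; rfl,
        show (4 * (r : ℤ)) = (4 * r : ℕ) by push_cast; rfl, zpow_natCast, zpow_natCast,
        show ((r : ℤ) + 1) = (r + 1 : ℕ) by push_cast; rfl, zpow_natCast]
      generalize (Nat.card K : ℝ) ^ (((4 * r : ℕ) : ℤ) * ((n : ℤ) - r)) = D
      rw [inv_pow, inv_pow, ← pow_mul, ← pow_mul]
      generalize (Nat.card K : ℝ) = q at *
      have a1 : q ^ (2 * (n + 1)) = (q ^ n) ^ 2 * q ^ 2 := by ring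
      have a2 : q ^ (2 * (r + 1)) = (q ^ r) ^ 2 * q ^ 2 := by ring
      have a3 : q ^ (2 * r + 2) = (q ^ r) ^ 2 * q ^ 2 := by ring
      have a4 : q ^ (2 * r + 1) = (q ^ r) ^ 2 * q := by ring
      have a5 : q ^ (2 * n + 1) = (q ^ n) ^ 2 * q := by ring
      have a6 : q ^ (4 * n) = (q ^ n) ^ 4 := by ring
      have a7 : q ^ (4 * r) = (q ^ r) ^ 4 := by ring
      rw [a1, a2, a3, a4, a5, a6, a7]
      have b1 : q ^ n ≠ 0 := by positivity
      have b2 : q ^ r ≠ 0 := by positivity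
      generalize q ^ n = s at *
      generalize q ^ r = t at *
      field_simp

end Finite

end LinearMap.BilinForm

/-! ### Involutions and their fixed spaces -/

namespace LinearMap.BilinForm

open Module
open LinearMap (BilinForm)

universe u v

variable {K : Type u} {V : Type v} [Field K] [AddCommGroup V] [Module K V] {B : BilinForm K V}
  [FiniteDimensional K V]

/-- In characteristic different from two, the isometric involutions of a nondegenerate reflexive
bilinear form correspond to its nondegenerate subspaces. -/
theorem card_isometric_involutions (h2 : (2 : K) ≠ 0) (hB : B.IsRefl) (hn : B.Nondegenerate) :
    Nat.card {g : V →ₗ[K] V // g ∘ₗ g = LinearMap.id ∧ ∀ x y, B (g x) (g y) = B x y} =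
      Nat.card {W : Submodule K V // B.NondegOn W} := by
  have hadd {a : K} (h : a + a = 0) : a = 0 := by
    rw [← two_mul] at h
    exact (mul_eq_zero.1 h).resolve_left h2
  have hinv (g : {g : V →ₗ[K] V // g ∘ₗ g = LinearMap.id ∧ ∀ x y, B (g x) (g y) = B x y}) (v : V) :
      g.1 (g.1 v) = v := LinearMap.congr_fun g.2.1 v
  have hnd (g : {g : V →ₗ[K] V // g ∘ₗ g = LinearMap.id ∧ ∀ x y, B (g x) (g y) = B x y}) :
      B.NondegOn (LinearMap.eqLocus g.1 LinearMap.id) := by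
    intro x hx h
    have hx' : g.1 x = x := hx
    -- The vector v + g v is fixed, and `B x (g v) = B x v` because x is fixed; orthogonality of x
    -- to v + g v thus says 2 B(x, v) = 0.
    refine hn.1 x fun v => hadd ?_
    have h3 := h (v + g.1 v) (by
      change g.1 (v + g.1 v) = v + g.1 v
      rw [map_add, hinv, add_comm])
    have h4 := g.2.2 x v
    rw [hx'] at h4
    rwa [map_add, h4] at h3
  refine Nat.card_congr (Equiv.ofBijective (fun g => ⟨_, hnd g⟩) ⟨?_, ?_⟩)
  -- On the complement of its fixed space g acts as -1: g v + v is fixed, yet orthogonal to every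
  -- fixed vector. So the fixed space determines g.
  · have key (g : {g : V →ₗ[K] V // g ∘ₗ g = LinearMap.id ∧ ∀ x y, B (g x) (g y) = B x y}) (v : V)
        (hv : v ∈ B.orthogonal (LinearMap.eqLocus g.1 LinearMap.id)) : g.1 v = -v := by
      refine eq_neg_of_add_eq_zero_left (hnd g _ ?_ fun y hy => hB _ _ ?_)
      · change g.1 (g.1 v + v) = g.1 v + v
        rw [map_add, hinv, add_comm]
      · have hy' : g.1 y = y := hy
        have h3 := g.2.2 y v
        rw [hy'] at h3
        have h4 : B y v = 0 := hv y hy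
        rw [map_add, h3, h4, add_zero]
    intro g g' h
    have h' : LinearMap.eqLocus g.1 LinearMap.id = LinearMap.eqLocus g'.1 LinearMap.id :=
      congrArg Subtype.val h
    refine Subtype.ext (LinearMap.ext fun v => ?_)
    obtain ⟨w, u, hw, hu, rfl⟩ :=
      Submodule.codisjoint_iff_exists_add_eq.1 ((hnd g).isCompl hB).codisjoint v
    have e1 : g.1 w = w := hw
    have e2 : g'.1 w = w := show w ∈ LinearMap.eqLocus g'.1 LinearMap.id from h' ▸ hw
    rw [map_add, map_add, key g u hu, key g' u (h' ▸ hu), e1, e2]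
  · intro ⟨W, hW⟩
    -- For surjectivity, let g be 1 on W and -1 on its orthogonal complement.
    have hc := hW.isCompl hB
    let g := LinearMap.ofIsCompl hc W.subtype (-(B.orthogonal W).subtype)
    have hg1 (w : V) (hw : w ∈ W) : g w = w := LinearMap.ofIsCompl_apply_left hc ⟨w, hw⟩
    have hg2 (u : V) (hu : u ∈ B.orthogonal W) : g u = -u :=
      LinearMap.ofIsCompl_apply_right hc ⟨u, hu⟩
    have hdec := Submodule.codisjoint_iff_exists_add_eq.1 hc.codisjoint
    refine ⟨⟨g, LinearMap.ext fun v => ?_, fun x y => ?_⟩, Subtype.ext ?_⟩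
    · obtain ⟨w, u, hw, hu, rfl⟩ := hdec v
      simp [hg1 w hw, hg2 u hu]
    · obtain ⟨w, u, hw, hu, rfl⟩ := hdec x
      obtain ⟨w', u', hw', hu', rfl⟩ := hdec y
      have e1 : B w u' = 0 := hu' w hw
      have e2 : B u w' = 0 := hB _ _ (hu w' hw')
      simp [hg1 w hw, hg2 u hu, hg1 w' hw', hg2 u' hu', e1, e2]
    · ext v
      change g v = v ↔ v ∈ W
      refine ⟨fun h => ?_, hg1 v⟩
      obtain ⟨w, u, hw, hu, rfl⟩ := hdec v
      rw [map_add, hg1 w hw, hg2 u hu, add_right_inj] at h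
      have : (2 : K) • u = 0 := by rw [two_smul]; nth_rw 1 [← h]; simp
      rw [(smul_eq_zero.1 this).resolve_left h2, add_zero]
      exact hw

/-- The number of nondegenerate subspaces of a symplectic space of dimension `2 n`, as a sum of
Gaussian binomial coefficients. -/
theorem hasSum_card_nondegOn [Finite K] (hB : B.IsAlt) (hn : B.Nondegenerate) {n : ℕ}
    (hV : finrank K V = 2 * n) :
    HasSum (fun r : ℤ => (Nat.card K : ℝ) ^ (4 * r * (n - r)) *
      (qPoch (((Nat.card K : ℝ) ^ 2)⁻¹) n * qPochInv (((Nat.card K : ℝ) ^ 2)⁻¹) r *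
        qPochInv (((Nat.card K : ℝ) ^ 2)⁻¹) (n - r)))
      (Nat.card {W : Submodule K V // B.NondegOn W}) := by
  classical
  have : Finite V := Module.finite_of_finite K
  have := Fintype.ofFinite {W : Submodule K V // B.NondegOn W}
  have hcard : Nat.card {W : Submodule K V // B.NondegOn W} = ∑ r ∈ Finset.range (n + 1),
      Nat.card {W : Submodule K V // B.NondegOn W ∧ finrank K W = 2 * r} := by
    rw [Nat.card_eq_fintype_card, ← Finset.card_univ,
      Finset.card_eq_sum_card_fiberwise (f := fun W => finrank K W.1 / 2)
        (t := Finset.range (n + 1)) (fun W _ => by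
          have := W.1.finrank_le
          simp only [Finset.coe_range, Set.mem_Iio]
          omega)]
    refine Finset.sum_congr rfl fun r _ => ?_
    rw [← Fintype.card_subtype, ← Nat.card_eq_fintype_card]
    refine Nat.card_congr ((Equiv.subtypeEquivRight fun W => ?_).trans
      (Equiv.subtypeSubtypeEquivSubtypeInter _ fun W : Submodule K V => finrank K W = 2 * r))
    -- The fibres are indexed by the rounded-down half of the dimension; evenness makes this
    -- determine the dimension.
    obtain ⟨k, hk⟩ := (hB.restrict W.1).even_finrank ((nondegOn_iff_restrict hB.isRefl).1 W.2)
    omega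
  rw [hcard, Nat.cast_sum, Finset.sum_congr rfl fun r _ => card_nondegOn hB hn hV r,
    ← (Nat.cast_injective (R := ℤ)).hasSum_iff]
  · refine hasSum_sum_of_ne_finset_zero fun r hr => ?_
    rw [Finset.mem_range] at hr
    rw [Function.comp_apply, qPochInv_of_neg _ (k := (n : ℤ) - r) (by omega), mul_zero, mul_zero]
  · intro r hr
    have h : r < 0 := by
      by_contra! h3
      exact hr ⟨r.toNat, by simp [h3]⟩
    simp [qPochInv_of_neg _ h]

end LinearMap.BilinForm

/-! ### Translation to the symplectic matrix group -/

section Symplectic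

variable {K : Type*} [Field K]

theorem isAlt_toBilin'_J (K : Type*) [Field K] (n : ℕ) :
    (Matrix.toBilin' (Matrix.J (Fin n) K)).IsAlt := by
  intro x
  simp [Matrix.toBilin'_apply', Matrix.J, Matrix.fromBlocks_mulVec, dotProduct, mul_comm,
    Matrix.neg_mulVec]

theorem nondegenerate_toBilin'_J (K : Type*) [Field K] (n : ℕ) :
    (Matrix.toBilin' (Matrix.J (Fin n) K)).Nondegenerate :=
  LinearMap.BilinForm.nondegenerate_toBilin'_of_det_ne_zero' _ (Matrix.isUnit_det_J (Fin n) K).ne_zero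

theorem toLin'_isometry_iff {n : ℕ} (A : Matrix (Fin n ⊕ Fin n) (Fin n ⊕ Fin n) K) :
    (∀ x y, Matrix.toBilin' (Matrix.J (Fin n) K) (A.toLin' x) (A.toLin' y) =
      Matrix.toBilin' (Matrix.J (Fin n) K) x y) ↔ A ∈ Matrix.symplecticGroup (Fin n) K := by
  rw [SymplecticGroup.mem_iff', ← Matrix.toBilin'.injective.eq_iff, ← Matrix.toBilin'_comp]
  exact ⟨fun h => LinearMap.ext₂ h, fun h x y => LinearMap.congr_fun₂ h x y⟩

theorem iSp_eq_card_nondegOn (h2 : (2 : K) ≠ 0) (n : ℕ) :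
    iSp n K = Nat.card {W : Submodule K (Fin n ⊕ Fin n → K) //
      (Matrix.toBilin' (Matrix.J (Fin n) K)).NondegOn W} := by
  rw [← LinearMap.BilinForm.card_isometric_involutions h2 (isAlt_toBilin'_J K n).isRefl
    (nondegenerate_toBilin'_J K n), iSp]
  refine Nat.card_congr ((Equiv.subtypeEquivRight fun g => ?_).trans
    ((Equiv.subtypeSubtypeEquivSubtypeInter (fun A => A ∈ Matrix.symplecticGroup (Fin n) K)
      (fun A => A ^ 2 = 1)).trans (Equiv.subtypeEquiv Matrix.toLin'.toEquiv fun A => ?_)))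
  · rw [← Subtype.coe_inj]
    rfl
  · change _ ↔ A.toLin' ∘ₗ A.toLin' = LinearMap.id ∧ ∀ x y, Matrix.toBilin' (Matrix.J (Fin n) K)
      (A.toLin' x) (A.toLin' y) = Matrix.toBilin' (Matrix.J (Fin n) K) x y
    rw [toLin'_isometry_iff, ← Matrix.toLin'_mul, ← Matrix.toLin'_one,
      Matrix.toLin'.injective.eq_iff, ← pow_two, and_comm]

/-- The number of involutions of the symplectic group, as a sum of Gaussian binomials. -/
theorem hasSum_iSp [Finite K] (h2 : (2 : K) ≠ 0) (n : ℕ) :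
    HasSum (fun r : ℤ => (Nat.card K : ℝ) ^ (4 * r * (n - r)) *
      (qPoch (((Nat.card K : ℝ) ^ 2)⁻¹) n * qPochInv (((Nat.card K : ℝ) ^ 2)⁻¹) r *
        qPochInv (((Nat.card K : ℝ) ^ 2)⁻¹) (n - r))) (iSp n K) := by
  rw [iSp_eq_card_nondegOn h2]
  refine LinearMap.BilinForm.hasSum_card_nondegOn (isAlt_toBilin'_J K n)
    (nondegenerate_toBilin'_J K n) ?_
  rw [Module.finrank_fintype_fun_eq_card, Fintype.card_sum, Fintype.card_fin, two_mul]

theorem iSpStrict_add_one (K : Type*) [Field K] [Finite K] (n : ℕ) :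
    iSpStrict n K + 1 = iSp n K := by
  have e : {g : Matrix.symplecticGroup (Fin n) K | g ^ 2 = 1} =
      insert 1 {g | orderOf g = 2} := by
    ext g
    rw [Set.mem_insert_iff, Set.mem_ofPred, Set.mem_ofPred]
    constructor
    · intro h
      by_cases h1 : g = 1
      · exact Or.inl h1
      · exact Or.inr (orderOf_eq_prime h h1)
    · rintro (rfl | h)
      · exact one_pow 2
      · rw [← h, pow_orderOf_eq_one]
  have := congrArg Set.ncard e
  rw [Set.ncard_insert_of_notMem (by simp)] at this
  exact this.symm

end Symplectic

/-! ### Reindexing and convergence of products -/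

theorem hasProd_pnat_iff_succPNat {f : ℕ+ → ℝ} {g : ℕ → ℝ} {a : ℝ}
    (h : ∀ i : ℕ, f i.succPNat = g i) : HasProd f a ↔ HasProd g a := by
  rw [← Equiv.pnatEquivNat.symm.hasProd_iff]
  exact (congrArg (fun f => HasProd f a) (funext h)).to_iff

theorem multipliable_one_add_mul_geometric {r : ℝ} (h0 : 0 < r) (h1 : r < 1) (c : ℝ) :
    Multipliable fun i : ℕ => 1 + c * r ^ i :=
  Real.multipliable_one_add_of_summable ((summable_geometric_of_lt_one h0.le h1).mul_left c)

theorem inv_pos_lt_one {q : ℝ} (hq : 1 < q) : 0 < q⁻¹ ∧ q⁻¹ < 1 :=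
  ⟨inv_pos.2 (by linarith), inv_lt_one_of_one_lt₀ hq⟩

/-! ### Theta series as infinite products -/

section Products

/-- The theta series `∑ z ^ j x ^ (j ^ 2)` over all integers `j`. -/
noncomputable def thetaSum (x z : ℝ) : ℝ := ∑' j : ℤ, z ^ j * x ^ (j ^ 2)

theorem hasSum_thetaSum {x : ℝ} (h0 : 0 < x) (h1 : x < 1) {z : ℝ} (hz : z ≠ 0) :
    HasSum (fun j : ℤ => z ^ j * x ^ (j ^ 2)) (thetaSum x z) :=
  (summable_zpow_mul_zpow_sq h0 h1 hz).hasSum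

/-- Odd indices cancel and even ones double; (2k)² = 4k² changes the base to x⁴. -/
theorem thetaSum_one_add_neg_one {x : ℝ} (h0 : 0 < x) (h1 : x < 1) :
    thetaSum x 1 + thetaSum x (-1) = 2 * thetaSum (x ^ 4) 1 := by
  have s := (hasSum_thetaSum h0 h1 one_ne_zero).add
    (hasSum_thetaSum h0 h1 (neg_ne_zero.2 one_ne_zero))
  have s' := (hasSum_thetaSum (pow_pos h0 4) (pow_lt_one₀ h0.le h1 four_ne_zero)
    one_ne_zero).mul_left 2
  have hi : Function.Injective fun k : ℤ => 2 * k := fun a b h => by simpa using h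
  rw [← hi.hasSum_iff] at s
  · refine s.unique ((congrArg (fun f => HasSum f _) (funext fun k => ?_)).mp s')
    have : x ^ ((2 * k) ^ 2) = (x ^ 4) ^ (k ^ 2) := by
      rw [show (2 * k) ^ 2 = ((4 : ℕ) : ℤ) * k ^ 2 by push_cast; ring, zpow_mul, zpow_natCast]
    simp only [Function.comp_apply, this, (even_two_mul k).neg_one_zpow]
    simp
    ring
  · intro j hj
    have hodd : Odd j := by
      rw [← Int.not_even_iff_odd]
      rintro ⟨k, rfl⟩
      exact hj ⟨k, by ring⟩
    simp [hodd.neg_one_zpow]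

/-- Now even indices cancel, and (2k+1)² = 4k² + 4k + 1 produces base x⁴, argument x⁴ and the extra
factor x. -/
theorem thetaSum_one_sub_neg_one {x : ℝ} (h0 : 0 < x) (h1 : x < 1) :
    thetaSum x 1 - thetaSum x (-1) = 2 * x * thetaSum (x ^ 4) (x ^ 4) := by
  have s := (hasSum_thetaSum h0 h1 one_ne_zero).sub
    (hasSum_thetaSum h0 h1 (neg_ne_zero.2 one_ne_zero))
  have s' := (hasSum_thetaSum (pow_pos h0 4) (pow_lt_one₀ h0.le h1 four_ne_zero)
    (pow_pos h0 4).ne').mul_left (2 * x)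
  have hi : Function.Injective fun k : ℤ => 2 * k + 1 := fun a b h => by simpa using h
  rw [← hi.hasSum_iff] at s
  · refine s.unique ((congrArg (fun f => HasSum f _) (funext fun k => ?_)).mp s')
    have : x ^ ((2 * k + 1) ^ 2) = (x ^ 4) ^ k * (x ^ 4) ^ (k ^ 2) * x := by
      rw [show (2 * k + 1) ^ 2 = ((4 : ℕ) : ℤ) * k + ((4 : ℕ) : ℤ) * k ^ 2 + 1 by push_cast; ring,
        zpow_add₀ h0.ne', zpow_add₀ h0.ne', zpow_mul, zpow_mul, zpow_natCast, zpow_one]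
    simp only [Function.comp_apply, this, (odd_two_mul_add_one k).neg_one_zpow]
    simp
    ring
  · intro j hj
    have heven : Even j := by
      rw [← Int.not_odd_iff_even]
      rintro ⟨k, rfl⟩
      exact hj ⟨k, rfl⟩
    simp [heven.neg_one_zpow]

/-- When z is its own inverse, the two factors of the triple product coincide. -/
theorem hasProd_one_add_sq {y : ℝ} (h0 : 0 < y) (h1 : y < 1) {z : ℝ} (hz : z ≠ 0) (hz' : z⁻¹ = z) :
    HasProd (fun i : ℕ => (1 + z * y ^ (2 * i + 1)) ^ 2) (thetaSum y z / qPochInf (y ^ 2)) := by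
  have hm := multipliable_one_add_mul_geometric (r := y ^ 2) (by positivity)
    (pow_lt_one₀ h0.le h1 two_ne_zero) (z * y)
  have hm2 : Multipliable fun i : ℕ => (1 + z * y ^ (2 * i + 1)) ^ 2 :=
    (hm.mul hm).congr fun i => by ring
  rw [hm2.hasProd_iff_tendsto_nat]
  refine (tendsto_jacobi_triple_product h0 h1 hz).congr fun m => Finset.prod_congr rfl fun i _ => ?_
  rw [hz', pow_two]

theorem multipliable_one_sub_pow_succ {y : ℝ} (h0 : 0 < y) (h1 : y < 1) :
    Multipliable fun i : ℕ => 1 - y ^ (i + 1) :=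
  (multipliable_one_add_mul_geometric h0 h1 (-y)).congr fun i => by ring

theorem hasProd_theta_even {y : ℝ} (h0 : 0 < y) (h1 : y < 1) :
    HasProd (fun i : ℕ => (1 + (y ^ 4) ^ (2 * i + 1)) ^ 2 * (1 - ((y ^ 4) ^ 2) ^ (i + 1)) /
      (1 - (y ^ 2) ^ (i + 1))) (thetaSum (y ^ 4) 1 / qPochInf (y ^ 2)) := by
  have x0 : 0 < y ^ 4 := by positivity
  have x1 : y ^ 4 < 1 := pow_lt_one₀ h0.le h1 four_ne_zero
  have a0 : 0 < (y ^ 4) ^ 2 := by positivity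
  have a1 : (y ^ 4) ^ 2 < 1 := pow_lt_one₀ x0.le x1 two_ne_zero
  have b0 : 0 < y ^ 2 := by positivity
  have b1 : y ^ 2 < 1 := pow_lt_one₀ h0.le h1 two_ne_zero
  have h := hasProd_one_add_sq x0 x1 one_ne_zero inv_one
  simp only [one_mul] at h
  have h' := (h.mul (multipliable_one_sub_pow_succ a0 a1).hasProd).div₀
    (multipliable_one_sub_pow_succ b0 b1).hasProd (qPochInf_pos b0 b1).ne'
  rw [← qPochInf, ← qPochInf, div_mul_cancel₀ _ (qPochInf_pos a0 a1).ne'] at h'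
  exact h'

theorem hasProd_theta_odd {y : ℝ} (h0 : 0 < y) (h1 : y < 1) :
    HasProd (fun i : ℕ => (1 + ((y ^ 4) ^ 2) ^ (i + 1)) * (1 - ((y ^ 4) ^ 4) ^ (i + 1)) /
      (1 - (y ^ 2) ^ (i + 1))) (thetaSum (y ^ 4) (y ^ 4) / 2 / qPochInf (y ^ 2)) := by
  have x0 : 0 < y ^ 4 := by positivity
  have x1 : y ^ 4 < 1 := pow_lt_one₀ h0.le h1 four_ne_zero
  have a0 : 0 < (y ^ 4) ^ 2 := by positivity
  have a1 : (y ^ 4) ^ 2 < 1 := pow_lt_one₀ x0.le x1 two_ne_zero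
  have b0 : 0 < y ^ 2 := by positivity
  have b1 : y ^ 2 < 1 := pow_lt_one₀ h0.le h1 two_ne_zero
  refine HasProd.div₀ ?_ (multipliable_one_sub_pow_succ b0 b1).hasProd (qPochInf_pos b0 b1).ne'
  have hm1 : Multipliable fun i : ℕ => 1 + ((y ^ 4) ^ 2) ^ (i + 1) :=
    (multipliable_one_add_mul_geometric a0 a1 ((y ^ 4) ^ 2)).congr fun i => by ring
  have hm := hm1.mul (multipliable_one_sub_pow_succ (y := (y ^ 4) ^ 4) (by positivity)
    (pow_lt_one₀ x0.le x1 four_ne_zero))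
  rw [hm.hasProd_iff_tendsto_nat]
  generalize y ^ 4 = x at *
  have t1 := tendsto_jacobi_triple_product x0 x1 x0.ne'
  have t2 := tendsto_qPoch a0 a1
  -- At z = x the triple product has factors (1 + x^(2i+2))(1 + x^(2i)). Shifting the second family
  -- by one index replaces its first factor 2 by 1 + x^(2m), which this correction records. Then (1
  -- + x^(2i+2))(1 - x^(2i+2)) = 1 - x^(4i+4).
  have t3 : Tendsto (fun m : ℕ => (1 + (x ^ 2) ^ m) / 2) atTop (𝓝 ((1 + 0) / 2)) :=
    ((tendsto_pow_atTop_nhds_zero_of_lt_one a0.le a1).const_add 1).div_const 2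
  have t := t3.mul (t1.mul t2)
  rw [div_mul_cancel₀ _ (qPochInf_pos a0 a1).ne', add_zero, one_div, inv_mul_eq_div] at t
  refine t.congr fun m => ?_
  induction m with
  | zero => simp [qPoch_zero]
  | succ m ih =>
    rw [Finset.prod_range_succ, Finset.prod_range_succ, ← ih, qPoch_succ]
    generalize (∏ i ∈ Finset.range m, _ : ℝ) = F
    have hx := x0.ne'
    field_simp
    ring

end Products

/-! ### Limits along even and odd n -/

section Limits

variable {K : Type*} [Field K] [Finite K]

theorem tendsto_iSp_even (h2 : (2 : K) ≠ 0) :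
    Tendsto (fun m : ℕ => (iSp (2 * m) K : ℝ) / (Nat.card K : ℝ) ^ ((2 * m) ^ 2)) atTop
      (𝓝 (thetaSum ((Nat.card K : ℝ)⁻¹ ^ 4) 1 / qPochInf ((Nat.card K : ℝ)⁻¹ ^ 2))) := by
  have hq : (1 : ℝ) < Nat.card K := by exact_mod_cast Finite.one_lt_card
  have hs := hasSum_iSp h2
  generalize (Nat.card K : ℝ) = q at *
  have hq0 : q ≠ 0 := by positivity
  obtain ⟨y0, y1⟩ := inv_pos_lt_one hq
  have hw := summable_zpow_mul_zpow_sq (pow_pos y0 4) (pow_lt_one₀ y0.le y1 four_ne_zero)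
    one_ne_zero
  have hc : Tendsto (fun m : ℕ => (m : ℤ)) atTop atTop := tendsto_natCast_atTop_atTop
  refine (tendsto_tsum_mul_gaussian (pow_pos y0 2) (pow_lt_one₀ y0.le y1 two_ne_zero) hw
    (tendsto_id.const_mul_atTop' two_pos) hc hc).congr fun m => ?_
  -- Centre the sum by r = m + j, where 4(m + j)(m - j) = (2m)² - 4j².
  have s := ((Equiv.addLeft (m : ℤ)).hasSum_iff.2 (hs (2 * m))).div_const (q ^ ((2 * m) ^ 2))
  rw [← s.tsum_eq]
  refine tsum_congr fun j => ?_
  simp only [Function.comp_apply, Equiv.coe_addLeft, id, one_zpow, one_mul, inv_pow]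
  rw [show ((2 * m : ℕ) : ℤ) - (m + j) = m - j by push_cast; ring, mul_div_right_comm]
  congr 1
  rw [eq_div_iff (by positivity), ← zpow_natCast, ← zpow_natCast, inv_zpow, ← zpow_mul,
    ← zpow_neg, ← zpow_add₀ hq0]
  congr 1
  push_cast
  ring

theorem tendsto_iSp_odd (h2 : (2 : K) ≠ 0) :
    Tendsto (fun m : ℕ => (iSp (2 * m + 1) K : ℝ) / (Nat.card K : ℝ) ^ ((2 * m + 1) ^ 2 - 1)) atTop
      (𝓝 (thetaSum ((Nat.card K : ℝ)⁻¹ ^ 4) ((Nat.card K : ℝ)⁻¹ ^ 4) /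
        qPochInf ((Nat.card K : ℝ)⁻¹ ^ 2))) := by
  have hq : (1 : ℝ) < Nat.card K := by exact_mod_cast Finite.one_lt_card
  have hs := hasSum_iSp h2
  generalize (Nat.card K : ℝ) = q at *
  have hq0 : q ≠ 0 := by positivity
  obtain ⟨y0, y1⟩ := inv_pos_lt_one hq
  have hw := summable_zpow_mul_zpow_sq (pow_pos y0 4) (pow_lt_one₀ y0.le y1 four_ne_zero)
    (pow_pos y0 4).ne'
  have hc : Tendsto (fun m : ℕ => (m : ℤ)) atTop atTop := tendsto_natCast_atTop_atTop
  refine (tendsto_tsum_mul_gaussian (pow_pos y0 2) (pow_lt_one₀ y0.le y1 two_ne_zero) hw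
    (e := fun m => 2 * m + 1) (tendsto_atTop_mono (fun m => show m ≤ _ by omega) tendsto_id)
    (tendsto_atTop_add_const_right _ 1 hc) hc).congr fun m => ?_
  -- Here r = m + 1 + j, and 4(m + 1 + j)(m - j) = (2m + 1)² - 1 - 4j² - 4j; the linear term gives
  -- the theta argument q⁻⁴.
  have s := ((Equiv.addLeft ((m : ℤ) + 1)).hasSum_iff.2 (hs (2 * m + 1))).div_const
    (q ^ ((2 * m + 1) ^ 2 - 1))
  rw [← s.tsum_eq]
  refine tsum_congr fun j => ?_
  simp only [Function.comp_apply, Equiv.coe_addLeft, inv_pow]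
  rw [show ((2 * m + 1 : ℕ) : ℤ) - (m + 1 + j) = m - j by push_cast; ring, mul_div_right_comm]
  congr 1
  rw [eq_div_iff (by positivity), show (2 * m + 1) ^ 2 - 1 = 4 * m ^ 2 + 4 * m by
      rw [Nat.sub_eq_iff_eq_add (Nat.one_le_pow _ _ (by omega))]; ring,
    ← zpow_natCast, ← zpow_natCast, inv_zpow, inv_zpow, ← zpow_mul, ← zpow_mul,
    ← zpow_neg, ← zpow_neg, ← zpow_add₀ hq0, ← zpow_add₀ hq0]
  congr 1
  push_cast
  ring

/-- The bound n ≤ 2m + 1 forces the parameter m to grow with n, so the limit in m passes to n in S.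
-/
theorem tendsto_inf_principal_of_comp {f : ℕ → ℝ} {l : Filter ℝ} {S : Set ℕ} {e : ℕ → ℕ}
    (he : ∀ n ∈ S, ∃ m, e m = n ∧ n ≤ 2 * m + 1) (h : Tendsto (fun m => f (e m)) atTop l) :
    Tendsto f (atTop ⊓ 𝓟 S) l := by
  intro s hs
  obtain ⟨M, hM⟩ := eventually_atTop.1 (h.eventually hs)
  rw [mem_map, mem_inf_principal]
  filter_upwards [eventually_ge_atTop (2 * M + 1)] with n hn hnS
  obtain ⟨m, rfl, hm⟩ := he n hnS
  exact hM m (by omega)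

end Limits

/-! ### Assembly of the theorem -/

theorem mainTheorem5 (K : Type*) [Field K] [Finite K] (q : ℕ) (hq : Nat.card K = q)
    (hodd : Odd q) (i : ℕ → ℕ)
    (hi : (∀ n, i n = iSp n K) ∨ (∀ n, i n = iSpStrict n K)) :
    -- the four infinite products converge
    (Multipliable (fun k : ℕ+ => (1 + 1 / (q : ℝ) ^ (2 * (k : ℤ) - 1)) ^ 2) ∧
      Multipliable (fun k : ℕ+ => (1 - 1 / (q : ℝ) ^ (2 * (k : ℤ) - 1)) ^ 2) ∧
      Multipliable (fun k : ℕ+ =>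
        (1 + (q : ℝ) ^ (4 - 8 * (k : ℤ))) ^ 2 * (1 - (q : ℝ) ^ (-8 * (k : ℤ))) /
          (1 - (q : ℝ) ^ (-2 * (k : ℤ)))) ∧
      Multipliable (fun k : ℕ+ =>
        (1 + (q : ℝ) ^ (-8 * (k : ℤ))) * (1 - (q : ℝ) ^ (-16 * (k : ℤ))) /
          (1 - (q : ℝ) ^ (-2 * (k : ℤ))))) ∧
    -- `n` even
    (Tendsto (fun n : ℕ => (i n : ℝ) / (q : ℝ) ^ (n ^ 2)) (atTop ⊓ 𝓟 {n : ℕ | Even n})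
        (𝓝 (1 / 2 * ((∏' k : ℕ+, (1 + 1 / (q : ℝ) ^ (2 * (k : ℤ) - 1)) ^ 2) +
          ∏' k : ℕ+, (1 - 1 / (q : ℝ) ^ (2 * (k : ℤ) - 1)) ^ 2))) ∧
      1 / 2 * ((∏' k : ℕ+, (1 + 1 / (q : ℝ) ^ (2 * (k : ℤ) - 1)) ^ 2) +
          ∏' k : ℕ+, (1 - 1 / (q : ℝ) ^ (2 * (k : ℤ) - 1)) ^ 2) =
        ∏' k : ℕ+, (1 + (q : ℝ) ^ (4 - 8 * (k : ℤ))) ^ 2 * (1 - (q : ℝ) ^ (-8 * (k : ℤ))) /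
          (1 - (q : ℝ) ^ (-2 * (k : ℤ)))) ∧
    -- `n` odd
    (Tendsto (fun n : ℕ => (i n : ℝ) / (q : ℝ) ^ (n ^ 2 - 1)) (atTop ⊓ 𝓟 {n : ℕ | Odd n})
        (𝓝 ((q : ℝ) / 2 * ((∏' k : ℕ+, (1 + 1 / (q : ℝ) ^ (2 * (k : ℤ) - 1)) ^ 2) -
          ∏' k : ℕ+, (1 - 1 / (q : ℝ) ^ (2 * (k : ℤ) - 1)) ^ 2))) ∧
      (q : ℝ) / 2 * ((∏' k : ℕ+, (1 + 1 / (q : ℝ) ^ (2 * (k : ℤ) - 1)) ^ 2) -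
          ∏' k : ℕ+, (1 - 1 / (q : ℝ) ^ (2 * (k : ℤ) - 1)) ^ 2) =
        2 * ∏' k : ℕ+, (1 + (q : ℝ) ^ (-8 * (k : ℤ))) * (1 - (q : ℝ) ^ (-16 * (k : ℤ))) /
          (1 - (q : ℝ) ^ (-2 * (k : ℤ)))) := by
  subst hq
  -- A finite field of characteristic two has even cardinality.
  have h2 : (2 : K) ≠ 0 := by
    have := Fintype.ofFinite K
    refine Ring.two_ne_zero fun h => ?_
    have := FiniteField.even_card_of_char_two h
    rw [← Nat.card_eq_fintype_card] at this
    exact (Nat.not_even_iff_odd.2 hodd) (Nat.even_iff.2 this)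
  have hcard : (1 : ℝ) < Nat.card K := by exact_mod_cast Finite.one_lt_card
  have hE := tendsto_iSp_even h2
  have hO := tendsto_iSp_odd h2
  generalize (Nat.card K : ℝ) = q at *
  obtain ⟨y0, y1⟩ := inv_pos_lt_one hcard
  have hq0 : q ≠ 0 := by positivity
  have H1 : HasProd (fun k : ℕ+ => (1 + 1 / q ^ (2 * (k : ℤ) - 1)) ^ 2) _ :=
    (hasProd_pnat_iff_succPNat fun i => by
      rw [one_mul, one_div, inv_pow, ← zpow_natCast q]
      congr 4
      push_cast [Nat.succPNat_coe]
      ring).2 (hasProd_one_add_sq y0 y1 one_ne_zero inv_one)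
  have H2 : HasProd (fun k : ℕ+ => (1 - 1 / q ^ (2 * (k : ℤ) - 1)) ^ 2) _ :=
    (hasProd_pnat_iff_succPNat fun i => by
      rw [neg_one_mul, ← sub_eq_add_neg, one_div, inv_pow, ← zpow_natCast q]
      congr 4
      push_cast [Nat.succPNat_coe]
      ring).2 (hasProd_one_add_sq y0 y1 (neg_ne_zero.2 one_ne_zero) inv_neg_one)
  have hpow {a : ℕ} {b : ℤ} (h : b = -a) : q ^ b = q⁻¹ ^ a := by
    rw [h, zpow_neg, zpow_natCast, inv_pow]
  have H3 : HasProd (fun k : ℕ+ => (1 + q ^ (4 - 8 * (k : ℤ))) ^ 2 * (1 - q ^ (-8 * (k : ℤ))) /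
      (1 - q ^ (-2 * (k : ℤ)))) _ :=
    (hasProd_pnat_iff_succPNat fun i => by
      rw [← pow_mul, ← pow_mul, ← pow_mul, ← pow_mul]
      rw [hpow (a := 4 * (2 * i + 1)) (by push_cast [Nat.succPNat_coe]; ring),
        hpow (a := 4 * (2 * (i + 1))) (by push_cast [Nat.succPNat_coe]; ring),
        hpow (a := 2 * (i + 1)) (by push_cast [Nat.succPNat_coe]; ring)]).2 (hasProd_theta_even y0 y1)
  have H4 : HasProd (fun k : ℕ+ => (1 + q ^ (-8 * (k : ℤ))) * (1 - q ^ (-16 * (k : ℤ))) /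
      (1 - q ^ (-2 * (k : ℤ)))) _ :=
    (hasProd_pnat_iff_succPNat fun i => by
      rw [← pow_mul, ← pow_mul, ← pow_mul, ← pow_mul, ← pow_mul]
      rw [hpow (a := 4 * (2 * (i + 1))) (by push_cast [Nat.succPNat_coe]; ring),
        hpow (a := 4 * (4 * (i + 1))) (by push_cast [Nat.succPNat_coe]; ring),
        hpow (a := 2 * (i + 1)) (by push_cast [Nat.succPNat_coe]; ring)]).2 (hasProd_theta_odd y0 y1)
  have e1 : 1 / 2 * (thetaSum q⁻¹ 1 / qPochInf (q⁻¹ ^ 2) +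
      thetaSum q⁻¹ (-1) / qPochInf (q⁻¹ ^ 2)) = thetaSum (q⁻¹ ^ 4) 1 / qPochInf (q⁻¹ ^ 2) := by
    rw [← add_div, thetaSum_one_add_neg_one y0 y1]
    ring
  have e2 : q / 2 * (thetaSum q⁻¹ 1 / qPochInf (q⁻¹ ^ 2) -
      thetaSum q⁻¹ (-1) / qPochInf (q⁻¹ ^ 2)) =
        thetaSum (q⁻¹ ^ 4) (q⁻¹ ^ 4) / qPochInf (q⁻¹ ^ 2) := by
    rw [← sub_div, thetaSum_one_sub_neg_one y0 y1]
    field_simp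
  -- whether or not the identity is counted does not affect the limits
  have hlim {e a : ℕ → ℕ} {L : ℝ} (ha : Tendsto a atTop atTop)
      (h : Tendsto (fun m => (iSp (e m) K : ℝ) / q ^ a m) atTop (𝓝 L)) :
      Tendsto (fun m => (i (e m) : ℝ) / q ^ a m) atTop (𝓝 L) := by
    rcases hi with hi | hi
    · simpa only [hi] using h
    · have h0 : Tendsto (fun m => (q⁻¹) ^ a m) atTop (𝓝 0) :=
        (tendsto_pow_atTop_nhds_zero_of_lt_one y0.le y1).comp ha
      have h3 := h.sub h0
      rw [sub_zero] at h3
      refine h3.congr fun m => ?_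
      rw [hi, ← iSpStrict_add_one, inv_pow]
      push_cast
      ring
  rw [H1.tprod_eq, H2.tprod_eq, H3.tprod_eq, H4.tprod_eq, e1, e2]
  refine ⟨⟨H1.multipliable, H2.multipliable, H3.multipliable, H4.multipliable⟩, ⟨?_, rfl⟩,
    ⟨?_, by ring⟩⟩
  · refine tendsto_inf_principal_of_comp (e := fun m => 2 * m)
      (fun n ⟨m, hm⟩ => ⟨m, by omega, by omega⟩) (hlim (a := fun m => (2 * m) ^ 2) ?_ hE)
    exact tendsto_atTop_mono (fun m => show m ≤ _ by nlinarith) tendsto_id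
  · refine tendsto_inf_principal_of_comp (e := fun m => 2 * m + 1)
      (fun n ⟨m, hm⟩ => ⟨m, by omega, by omega⟩) (hlim (a := fun m => (2 * m + 1) ^ 2 - 1) ?_ hO)
    exact tendsto_atTop_mono (fun m => show m ≤ _ from Nat.le_sub_one_of_lt (by nlinarith)) tendsto_id
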